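/- Let $H$ be the (pairwise commuting) checks of an arbitrary LDPC stabilizer code, not necessarily CSS, of distance $d$: each check acts on at most $w$ qubits and each qubit is acted upon by at most $w$ checks. Let $Z(\mathcal L_Z)$ and $X(\mathcal L_X)$ be two nontrivial logical operators of it, with disjoint supports $\mathcal L_Z\cap\mathcal L_X=\emptyset$. Let $D\ge 1$, and take the $D\times D$ toric code: for $i,j\in\mathbb Z/D$ it has primal qubits $\mathcal Q^Z_i(j)$, dual qubits $\mathcal Q^X_i(j)$, $X$-checks $\mathcal C^X_i(j)$ acting on $\mathcal Q^Z_i$ by row $j$ of $H_C$ and on $\mathcal Q^X_i(j)$ and $\mathcal Q^X_{i-1}(j)$, and $Z$-checks $\mathcal C^Z_i(j)$ acting on $\mathcal Q^X_i$ by row $j$ of $H_C^\top$ and on $\mathcal Q^Z_i(j)$ and $\mathcal Q^Z_{i+1}(j)$. Here $H_C=I+C$, with $C$ the cyclic shift $e_jC=e_{j+1}$, and all matrices are over $\mathbb F_2$. For $\sigma\in\{Z,X\}$ let $\mathcal G_\sigma=(\mathcal V_\sigma,\mathcal E_\sigma)$ be a finite loopless graph (multiple edges allowed) with incidence matrix $G_\sigma\in\mathbb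 F_2^{\mathcal E_\sigma\times\mathcal V_\sigma}$ and an injective port function $f_\sigma:\mathcal L_\sigma\to\mathcal V_\sigma$ with matrix $F_\sigma$, such that: (0) $\mathcal G_\sigma$ is connected; (1) all its degrees are at most $w$; (2) there is a matrix $M_\sigma$, with row and column weights at most $w$, whose row $s$, for each check $s$ of the original code, is a set of edges matching the vertices $f_\sigma(\mathcal L_s)$, where $\mathcal L_s$ is the set of qubits of $\mathcal L_\sigma$ at which $s$ anticommutes locally with the logical operator; that is, $M_\sigma G_\sigma=S_\sigma F_\sigma$, where $S_Z$ and $S_X$ are the $X$-part and the $Z$-part of $H$, respectively; (3) there is a matrix $N_\sigma$, with row and column weights at most $w$, whose rows generate the cycle space $\{z: zG_\sigma=0\}$. The number $w$ is arbitrary, and no expansion is required. Let $T_\sigma,P_\sigma$ be a SkipTree adapter: $D$ distinct vertices of $\mathcal G_\sigma$, among them all vertices in the image of $f_\sigma$, are labelled by $\mathbb Z/D$, $P_\sigma\in\mathbb F_2^{\mathcal V_\sigma\times D}$ is the matrix of this labelling, $T_\sigma\in\mathbb F_2^{D\times\mathcal E_\sigma}$ has row weights at most $3$ and column weights at most $2$,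 and $T_\sigma G_\sigma=H_CP_\sigma^\top$ (so $T_\sigma G_\sigma P_\sigma=H_C$). In particular $D\ge\max(|\mathcal L_Z|,|\mathcal L_X|)$. The merged code has as qubits those of the original code, one for each edge of $\mathcal G_Z$ and of $\mathcal G_X$, and the toric qubits. Its checks are: the original checks $s$, extended by $X$ on row $s$ of $M_Z$ and by $Z$ on row $s$ of $M_X$; for each row of $N_Z$ the $X$-check, and for each row of $N_X$ the $Z$-check, on the edges in that row; for each vertex $v$ of $\mathcal G_Z$ the $Z$-check acting on the edges at $v$, on the qubit $f_Z^{-1}(v)$ if there is one, and on $\mathcal Q^Z_0(j)$ if $v$ has a label $j$; for each vertex $v$ of $\mathcal G_X$ the $X$-check acting on the edges at $v$, on the qubit $f_X^{-1}(v)$ if there is one, and on $\mathcal Q^X_{D-1}(j)$ if $v$ has a label $j$; and the toric checks, where $\mathcal C^X_0(j)$ is extended by $X$ on row $j$ of $T_Z$ and $\mathcal C^Z_{D-1}(j)$ by $Z$ on row $j-1$ of $T_X$. Then all checks of the merged code commute, and its distance $d'$ (the minimum weight of a logical operator that is not a product of checks, which exists) satisfies $d'\ge d$. If $D=d$, or more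 generally if $|\mathcal L_Z|=d$ or $|\mathcal L_X|=d$, then $d'=d$. -/

import Mathlib

namespace ToricMerge

/-! ### Stabilizer codes in the symplectic picture -/

/-- A Pauli operator on the qubits `Q`, up to phase: `(u, v)` stands for `X(u) Z(v)`. -/
abbrev Pauli (Q : Type*) := (Q → ZMod 2) × (Q → ZMod 2)

/-- Two Pauli operators commute: their symplectic product vanishes. -/
def Commutes {Q : Type*} [Fintype Q] (A B : Pauli Q) : Prop :=
  A.1 ⬝ᵥ B.2 + A.2 ⬝ᵥ B.1 = 0

/-- The number of qubits on which a Pauli operator acts nontrivially. -/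
def weight {Q : Type*} [Fintype Q] (A : Pauli Q) : ℕ :=
  (Finset.univ.filter fun q => A.1 q ≠ 0 ∨ A.2 q ≠ 0).card

/-- A family of checks defines a stabilizer code if the checks commute pairwise. -/
def IsStabilizerCode {Q C : Type*} [Fintype Q] (H : C → Pauli Q) : Prop :=
  ∀ a b, Commutes (H a) (H b)

/-- A logical operator that is not a product of checks. -/
def IsNontrivialLogical {Q C : Type*} [Fintype Q] (H : C → Pauli Q) (A : Pauli Q) : Prop :=
  (∀ a, Commutes (H a) A) ∧ A ∉ Submodule.span (ZMod 2) (Set.range H)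

/-- `d` is the minimum weight of a nontrivial logical operator (in particular, one exists). -/
def HasDistance {Q C : Type*} [Fintype Q] (H : C → Pauli Q) (d : ℕ) : Prop :=
  IsLeast {n | ∃ A, IsNontrivialLogical H A ∧ weight A = n} d

/-- Each check acts on at most `w` qubits, each qubit is acted upon by at most `w` checks. -/
def IsLDPC {Q C : Type*} [Fintype Q] [Fintype C] (w : ℕ) (H : C → Pauli Q) : Prop :=
  (∀ a, weight (H a) ≤ w) ∧
    ∀ q, (Finset.univ.filter fun a => (H a).1 q ≠ 0 ∨ (H a).2 q ≠ 0).card ≤ w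

/-- The operator `X(S)`. -/
def xOp {Q : Type*} [DecidableEq Q] (S : Finset Q) : Pauli Q :=
  (fun q => if q ∈ S then 1 else 0, 0)

/-- The operator `Z(S)`. -/
def zOp {Q : Type*} [DecidableEq Q] (S : Finset Q) : Pauli Q :=
  (0, fun q => if q ∈ S then 1 else 0)

/-- Row weights at most `r`, column weights at most `c`. -/
def IsSparse {m n : Type*} [Fintype m] [Fintype n] (r c : ℕ) (A : Matrix m n (ZMod 2)) : Prop :=
  (∀ i, (Finset.univ.filter fun j => A i j ≠ 0).card ≤ r) ∧
    ∀ j, (Finset.univ.filter fun i => A i j ≠ 0).card ≤ c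

/-! ### The toric code

The qubits of the `D × D` toric code are two copies of `ZMod D × ZMod D`: the `j`-th qubit of
the `i`-th primal layer `Q^Z_i`, and the `j`-th qubit of the `i`-th dual layer `Q^X_i`, have
index `(i, j)` in their respective copies. The checks `C^X_i` and `C^Z_i` are indexed likewise. -/

/-- The cyclic shift, `e_i C = e_{i+1}`. -/
def shift (D : ℕ) : Matrix (ZMod D) (ZMod D) (ZMod 2) :=
  Matrix.of fun i j => if j = i + 1 then 1 else 0

/-- The cyclic check matrix `H_C = I + C` of the repetition code. -/
def cyc (D : ℕ) : Matrix (ZMod D) (ZMod D) (ZMod 2) := 1 + shift D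

/-- The vector supported on layer `i`, where it is `u`. -/
def onLayer {D : ℕ} (i : ZMod D) (u : ZMod D → ZMod 2) : ZMod D × ZMod D → ZMod 2 :=
  fun k => if k.1 = i then u k.2 else 0

/-- Action of the `j`-th check of `C^X_i` on the primal qubits. -/
def toricXPrimal {D : ℕ} (i j : ZMod D) : ZMod D × ZMod D → ZMod 2 :=
  onLayer i (cyc D j)

/-- Action of the `j`-th check of `C^X_i` on the dual qubits. -/
def toricXDual {D : ℕ} (i j : ZMod D) : ZMod D × ZMod D → ZMod 2 :=
  onLayer i (Pi.single j 1) + onLayer (i - 1) (Pi.single j 1)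

/-- Action of the `j`-th check of `C^Z_i` on the primal qubits. -/
def toricZPrimal {D : ℕ} (i j : ZMod D) : ZMod D × ZMod D → ZMod 2 :=
  onLayer i (Pi.single j 1) + onLayer (i + 1) (Pi.single j 1)

/-- Action of the `j`-th check of `C^Z_i` on the dual qubits. -/
def toricZDual {D : ℕ} (i j : ZMod D) : ZMod D × ZMod D → ZMod 2 :=
  onLayer i ((cyc D).transpose j)

/-! ### Auxiliary graphs -/

/-- A loopless (multi)graph with vertices `V` and edges `E`. -/
structure AuxGraph (V E : Type*) where
  /-- the two endpoints of an edge -/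
  ends : E → Sym2 V
  loopless : ∀ e, ¬ (ends e).IsDiag

/-- The incidence matrix. -/
def AuxGraph.inc {V E : Type*} [DecidableEq V] (G : AuxGraph V E) : Matrix E V (ZMod 2) :=
  Matrix.of fun e v => if v ∈ G.ends e then 1 else 0

/-- Connectedness. -/
def AuxGraph.IsConnected {V E : Type*} (G : AuxGraph V E) : Prop :=
  (SimpleGraph.fromEdgeSet (Set.range G.ends)).Connected

/-- The data by which a logical operator supported on `L` is connected to one side of the
`D × D` toric code. Here `C` indexes the checks of the original code, `V` and `E` are the vertices
and edges of the auxiliary graph, and `U` indexes a basis of its cycles. -/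
structure Attachment (C V E U : Type*) {Q : Type*} (L : Finset Q) (D : ℕ) where
  /-- the auxiliary graph -/
  graph : AuxGraph V E
  /-- the port function `f`, which attaches the qubits of `L` to vertices -/
  port : L ↪ V
  /-- `M`: row `s` is the set of edges `μ(L_s)` matching the vertices `f(L_s)` -/
  matching : Matrix C E (ZMod 2)
  /-- `N`: its rows are the basis cycles -/
  cycles : Matrix U E (ZMod 2)
  /-- the vertices attached to the toric code; vertex `toricPort j` carries the label `j` -/
  toricPort : ZMod D ↪ V
  /-- `T`: row `j` is the set of edges attached to the `j`-th repetition-code check -/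
  trans : Matrix (ZMod D) E (ZMod 2)

namespace Attachment

variable {C V E U Q : Type*} {L : Finset Q} {D : ℕ}

/-- The matrix `F` of the port function. -/
def portMatrix [DecidableEq Q] [DecidableEq V] (A : Attachment C V E U L D) :
    Matrix Q V (ZMod 2) :=
  Matrix.of fun q v => if ∃ h : q ∈ L, A.port ⟨q, h⟩ = v then 1 else 0

/-- The matrix `P` of the labelling (a permutation matrix if every vertex has a label, and a
permutation matrix with zero rows inserted otherwise). -/
def labelMatrix [DecidableEq V] (A : Attachment C V E U L D) : Matrix V (ZMod D) (ZMod 2) :=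
  Matrix.of fun v j => if A.toricPort j = v then 1 else 0

/-- The graph desiderata 0 to 3, with the constant `w` in place of `O(1)`. Row `s` of `S` is the
part of the check `s` of the original code that anticommutes locally with the logical
operator on `L`. No expansion is required. -/
structure Desiderata [DecidableEq Q] [Fintype Q] [Fintype C] [DecidableEq V] [Fintype V]
    [Fintype E] [Fintype U] (A : Attachment C V E U L D) (S : Matrix C Q (ZMod 2)) (w : ℕ) :
    Prop where
  /-- (0) the graph is connected -/
  connected : A.graph.IsConnected
  /-- (1) its degrees are bounded -/
  degree_le : ∀ v, (Finset.univ.filter fun e => v ∈ A.graph.ends e).card ≤ w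
  /-- (2) the edges in `μ(L_s)` match the vertices in `f(L_s)`: as a sum of paths, they have
  boundary `f(L_s)` -/
  matching_boundary : A.matching * A.graph.inc = S * A.portMatrix
  /-- (2) each matching is short, and each edge is in few matchings -/
  matching_sparse : IsSparse w w A.matching
  /-- (3) the chosen cycles generate the cycle space of the graph -/
  cycles_span : Submodule.span (ZMod 2) (Set.range A.cycles) =
    LinearMap.ker A.graph.inc.vecMulLinear
  /-- (3) each chosen cycle is short, and each edge is in few of them -/
  cycles_sparse : IsSparse w w A.cycles

/-- `T` and `P` form a SkipTree basis change `T G P = H_C` at the vertices attached to the toric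
code: every row of `T` is a set of edges joining the consecutive labels `j` and `j + 1`, and `T` is
`(3,2)`-sparse. All vertices attached to the code are attached to the toric code, too. -/
structure IsSkipTree [DecidableEq V] [Fintype V] [Fintype E] [NeZero D]
    (A : Attachment C V E U L D) : Prop where
  basis_change : A.trans * A.graph.inc = cyc D * A.labelMatrix.transpose
  trans_sparse : IsSparse 3 2 A.trans
  port_subset : Set.range A.port ⊆ Set.range A.toricPort

end Attachment

/-! ### The merged code -/

/-- The qubits of the merged code: those of the original code, the edges of `G_Z`, the edges of
`G_X`, the primal and the dual qubits of the toric code. -/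
abbrev MergedQubit (Q EZ EX : Type*) (D : ℕ) :=
  Q ⊕ EZ ⊕ EX ⊕ (ZMod D × ZMod D) ⊕ (ZMod D × ZMod D)

/-- The checks of the merged code: those of the original code, the cycles of `G_Z`, the cycles of
`G_X`, the vertices of `G_Z`, the vertices of `G_X`, the toric checks `C^X` and `C^Z`. -/
abbrev MergedCheck (C UZ UX VZ VX : Type*) (D : ℕ) :=
  C ⊕ UZ ⊕ UX ⊕ VZ ⊕ VX ⊕ (ZMod D × ZMod D) ⊕ (ZMod D × ZMod D)

/-- A vector on all qubits of the merged code, from its parts. -/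
def assemble {Q EZ EX : Type*} {D : ℕ} (q : Q → ZMod 2) (eZ : EZ → ZMod 2) (eX : EX → ZMod 2)
    (primal dual : ZMod D × ZMod D → ZMod 2) : MergedQubit Q EZ EX D → ZMod 2 :=
  Sum.elim q (Sum.elim eZ (Sum.elim eX (Sum.elim primal dual)))

/-- The checks of the merged code. The toric code is attached to `G_Z` at the layer `Q^Z_0, C^X_0`
and to `G_X` at the layer `Q^X_{D-1}, C^Z_{D-1}`; the `j`-th check of the latter joins the
labels `j - 1` and `j`, so it is attached to row `j - 1` of `T_X`. -/
def mergedCode {Q C VZ EZ UZ VX EX UX : Type*} [DecidableEq Q] [DecidableEq VZ] [DecidableEq VX]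
    {LZ LX : Finset Q} {D : ℕ} (H : C → Pauli Q) (AZ : Attachment C VZ EZ UZ LZ D)
    (AX : Attachment C VX EX UX LX D) :
    MergedCheck C UZ UX VZ VX D → Pauli (MergedQubit Q EZ EX D)
  | .inl s => (assemble (H s).1 (AZ.matching s) 0 0 0, assemble (H s).2 0 (AX.matching s) 0 0)
  | .inr (.inl c) => (assemble 0 (AZ.cycles c) 0 0 0, 0)
  | .inr (.inr (.inl c)) => (0, assemble 0 0 (AX.cycles c) 0 0)
  | .inr (.inr (.inr (.inl v))) =>
      (0, assemble (fun q => AZ.portMatrix q v) (fun e => AZ.graph.inc e v) 0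
        (onLayer 0 (AZ.labelMatrix v)) 0)
  | .inr (.inr (.inr (.inr (.inl v)))) =>
      (assemble (fun q => AX.portMatrix q v) 0 (fun e => AX.graph.inc e v) 0
        (onLayer (-1) (AX.labelMatrix v)), 0)
  | .inr (.inr (.inr (.inr (.inr (.inl (i, j)))))) =>
      (assemble 0 (if i = 0 then AZ.trans j else 0) 0 (toricXPrimal i j) (toricXDual i j), 0)
  | .inr (.inr (.inr (.inr (.inr (.inr (i, j)))))) =>
      (0, assemble 0 0 (if i = -1 then AX.trans (j - 1) else 0) (toricZPrimal i j)
        (toricZDual i j))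

end ToricMerge

open ToricMerge

namespace ToricMerge

/-! ### Linear algebra over `ZMod 2` -/

/-! Lower bound: every nontrivial logical operator of the merged code is cleaned to one of the
original code that is no heavier (`exists_isNontrivialLogical_weight_le`). Since the chosen cycles
generate the cycle space, commuting with the cycle checks forces the Z-part on the edges of G_Z to
be a coboundary G a. The toric X-checks, summed over all layers, show that a at label j and the sum
of the primal Z-part over column j differ by a constant, which can be absorbed into a
(`Attachment.exists_vertex_set`). Multiplying by the vertex checks in a therefore clears these edges
and the toric homology class at once; the same holds for the X-part on G_X and the dual qubits.

What remains on the original qubits is a logical operator B. If B were a product of original checks,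
the whole operator would be a product of checks: the rest is homologically trivial on the toric
code, and it is filled in by toric and cycle checks (`mem_span_mergedCode`).

The weight does not grow, and no expansion is needed: the cleaning changes a qubit of L_Z only if
the column of its label has odd Z-weight on the primal qubits, so each changed qubit is charged to a
toric qubit in its own column (`Attachment.card_portMatrix_mulVec_le`).

Upper bound: as the supports are disjoint, Z(L_Z) and X(L_X) commute with the vertex checks, and
they stay nontrivial (`IsNontrivialLogical.extend`). The ports lie among D labelled vertices, so L_Z
has at most D qubits. -/

theorem exists_mulVec_eq_of_forall_vecMul {m n K : Type*} [Fintype m] [Fintype n] [Field K]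
    (A : Matrix m n K) (z : m → K) (h : ∀ y, Matrix.vecMul y A = 0 → y ⬝ᵥ z = 0) :
    ∃ a, A.mulVec a = z := by
  classical
  have hz : z ∈ LinearMap.range A.mulVecLin := by
    by_contra hz
    -- A functional that separates `z` from the range is a dot product with some y; vanishing on the
    -- range means y A = 0.
    obtain ⟨f, hf, hfz⟩ := Submodule.exists_le_ker_of_notMem hz
    have hrep : ∀ u, f u = (fun i => f (Pi.single i 1)) ⬝ᵥ u := by
      intro u
      conv_lhs => rw [pi_eq_sum_univ' u]
      simp [dotProduct, mul_comm]
    apply hf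
    rw [hrep]
    apply h
    ext j
    have := hfz ⟨Pi.single j 1, rfl⟩
    rw [LinearMap.mem_ker, hrep] at this
    simpa [Matrix.vecMul, dotProduct] using this
  simpa using hz

theorem add_self_fun {α : Type*} (f : α → ZMod 2) : f + f = 0 := by
  funext i; exact CharTwo.add_self_eq_zero _

/-! ### Cyclic sums -/

theorem eq_of_shift_eq {D : ℕ} [NeZero D] {α : Type*} (s : ZMod D → α)
    (h : ∀ j, s (j + 1) = s j) (j k : ZMod D) : s j = s k := by
  have key : ∀ n : ℕ, s (n : ZMod D) = s 0 := by
    intro n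
    induction n with
    | zero => simp
    | succ n ih => rw [Nat.cast_succ, h, ih]
  have := key j.val
  have := key k.val
  simp_all

/-- Partial sums starting at 0 are a primitive; the vanishing total makes them close up around the
cycle. -/
theorem exists_cyclic_primitive {D : ℕ} [NeZero D] (u : ZMod D → ZMod 2) (hu : ∑ j, u j = 0) :
    ∃ t : ZMod D → ZMod 2, ∀ j, u j = t j + t (j + 1) := by
  let S : ℕ → ZMod 2 := fun n => ∑ k ∈ Finset.range n, u (k : ZMod D)
  have hS : S D = 0 := by
    rw [← hu]
    refine Finset.sum_bij' (fun k _ => (k : ZMod D)) (fun j _ => j.val) ?_ ?_ ?_ ?_ ?_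
    · simp
    · intro j _; simpa using ZMod.val_lt j
    · intro k hk; exact ZMod.val_cast_of_lt (by simpa using hk)
    · intro j _; simp
    · simp
  refine ⟨fun j => S j.val, fun j => ?_⟩
  have hsucc : S (j.val + 1) = S j.val + u j := by
    simp [S, Finset.sum_range_succ]
  have hval : S (j + 1).val = S (j.val + 1) := by
    have hlt := ZMod.val_lt j
    have hcast : (j + 1) = ((j.val + 1 : ℕ) : ZMod D) := by simp
    rcases Nat.lt_or_ge (j.val + 1) D with h | h
    · rw [hcast, ZMod.val_cast_of_lt h]
    -- The wraparound j = D - 1, the only place where the total sum enters.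
    · have h' : j.val + 1 = D := by omega
      rw [hcast, h', hS]
      simp [S]
  show u j = S j.val + S (j + 1).val
  rw [hval, hsucc]
  linear_combination -(CharTwo.add_self_eq_zero (S j.val))

/-- Exactness of the toric code at a chain with trivial homology class. -/
theorem exists_toric_primitive {D : ℕ} [NeZero D] (p q : ZMod D → ZMod D → ZMod 2)
    (h : ∀ i j, q i j + q i (j - 1) + p i j + p (i + 1) j = 0)
    (hq : ∀ j, ∑ i, q i j = 0) (hp : ∀ i, ∑ j, p i j = 0) :
    ∃ t : ZMod D → ZMod D → ZMod 2,
      (∀ i j, p i j = t i j + t i (j - 1)) ∧ ∀ i j, q i j = t i j + t (i + 1) j := by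
  choose t ht using fun j => exists_cyclic_primitive (fun i => q i j) (hq j)
  -- The columnwise primitives `t` account for `q`; `r` is their defect on `p`. The boundary
  -- condition makes it independent of the layer, so a correction `c j` constant in `i` removes it
  -- without affecting `q`.
  let r : ZMod D → ZMod D → ZMod 2 := fun i j => p i j + t j i + t (j - 1) i
  have hr : ∀ i j, r i j = r 0 j := by
    intro i j
    refine eq_of_shift_eq (fun i => r i j) (fun i => ?_) i 0
    have h0 := h i j
    have h1 := ht j i
    have h2 := ht (j - 1) i
    simp only [r] at *
    rw [h1, h2] at h0
    rw [← CharTwo.sub_eq_add, ← sub_eq_zero]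
    simp only [CharTwo.sub_eq_add] at h0 ⊢
    linear_combination h0
  have hr0 : ∑ j, r 0 (j + 1) = 0 := by
    rw [show ∑ j : ZMod D, r 0 (j + 1) = ∑ j, r 0 j from
      Equiv.sum_comp (Equiv.addRight (1 : ZMod D)) (fun j => r 0 j)]
    simp only [r, Finset.sum_add_distrib, hp]
    rw [show ∑ j : ZMod D, t (j - 1) 0 = ∑ j, t j 0 from
      Equiv.sum_comp (Equiv.subRight (1 : ZMod D)) (fun j => t j 0)]
    rw [zero_add, CharTwo.add_self_eq_zero]
  obtain ⟨c, hc⟩ := exists_cyclic_primitive _ hr0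
  refine ⟨fun i j => t j i + c j, fun i j => ?_, fun i j => ?_⟩
  · have h1 := hr i j
    have h2 := hc (j - 1)
    simp only [sub_add_cancel] at h2
    rw [h2] at h1
    simp only [r] at h1
    have e1 := CharTwo.add_self_eq_zero (t j i)
    have e2 := CharTwo.add_self_eq_zero (t (j - 1) i)
    linear_combination h1 - e1 - e2
  · have e := CharTwo.add_self_eq_zero (c j)
    simp only [ht j i]
    linear_combination -e

/-! ### Auxiliary graphs -/

section Graph

variable {V E : Type*} [Fintype V] [DecidableEq V] (G : AuxGraph V E)

theorem AuxGraph.inc_mulVec {e : E} {u v : V} (he : G.ends e = s(u, v)) (a : V → ZMod 2) :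
    G.inc.mulVec a e = a u + a v := by
  have huv : u ≠ v := by
    have := G.loopless e
    rwa [he, Sym2.mk_isDiag_iff] at this
  have : ∀ x, G.inc e x * a x = (if x = u then a x else 0) + (if x = v then a x else 0) := by
    intro x
    by_cases h1 : x = u
    · subst h1; simp [AuxGraph.inc, he, huv]
    · by_cases h2 : x = v
      · subst h2; simp [AuxGraph.inc, he, h1]
      · simp [AuxGraph.inc, he, h1, h2]
  simp [Matrix.mulVec, dotProduct, this, Finset.sum_add_distrib]

theorem AuxGraph.inc_mulVec_const (c : ZMod 2) : G.inc.mulVec (fun _ => c) = 0 := by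
  funext e
  obtain ⟨u, v, h⟩ : ∃ u v, G.ends e = s(u, v) := by
    induction h : G.ends e with | _ u v => exact ⟨u, v, rfl⟩
  rw [G.inc_mulVec h]
  exact CharTwo.add_self_eq_zero c

/-- Each edge forces equal values at its two ends; propagate along a walk. -/
theorem AuxGraph.eq_of_inc_mulVec_eq_zero (hG : G.IsConnected) {a : V → ZMod 2}
    (ha : G.inc.mulVec a = 0) (u v : V) : a u = a v := by
  obtain ⟨p⟩ := hG.preconnected u v
  induction p with
  | nil => rfl
  | @cons x y _ hxy _ ih =>
    rw [← ih]
    obtain ⟨⟨e, he⟩, -⟩ := (SimpleGraph.fromEdgeSet_adj _).1 hxy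
    have := congrFun ha e
    rw [G.inc_mulVec he] at this
    exact CharTwo.add_eq_zero.1 this

end Graph

/-! ### The repetition code and the attachments -/

theorem cyc_apply {D : ℕ} (j : ZMod D) : cyc D j = Pi.single j 1 + Pi.single (j + 1) 1 := by
  ext k
  simp [cyc, shift, Matrix.one_apply, Pi.single_apply, eq_comm]

theorem cyc_transpose_apply {D : ℕ} (j : ZMod D) :
    (cyc D).transpose j = Pi.single j 1 + Pi.single (j - 1) 1 := by
  ext k
  simp [cyc, shift, Matrix.one_apply, Pi.single_apply, eq_sub_iff_add_eq, eq_comm (a := j)]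

theorem cyc_mulVec {D : ℕ} [NeZero D] (x : ZMod D → ZMod 2) (j : ZMod D) :
    (cyc D).mulVec x j = x j + x (j + 1) := by
  rw [Matrix.mulVec, cyc_apply, add_dotProduct]
  simp

theorem vecMul_cyc {D : ℕ} [NeZero D] (x : ZMod D → ZMod 2) (j : ZMod D) :
    Matrix.vecMul x (cyc D) j = x j + x (j - 1) := by
  rw [← Matrix.mulVec_transpose, Matrix.mulVec, cyc_transpose_apply, add_dotProduct]
  simp

namespace Attachment

variable {C V E U Q : Type*} {L : Finset Q} {D : ℕ}

theorem labelMatrix_transpose_mulVec [Fintype V] [DecidableEq V] (A : Attachment C V E U L D)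
    (a : V → ZMod 2) (j : ZMod D) : A.labelMatrix.transpose.mulVec a j = a (A.toricPort j) := by
  simp [Matrix.mulVec, dotProduct, labelMatrix]

theorem vecMul_labelMatrix [Fintype V] [DecidableEq V] (A : Attachment C V E U L D)
    (a : V → ZMod 2) (j : ZMod D) : Matrix.vecMul a A.labelMatrix j = a (A.toricPort j) := by
  simp [Matrix.vecMul, dotProduct, labelMatrix]

theorem sum_labelMatrix_mulVec [Fintype V] [DecidableEq V] [NeZero D]
    (A : Attachment C V E U L D) (x : ZMod D → ZMod 2) :
    ∑ v, A.labelMatrix.mulVec x v = ∑ j, x j := by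
  simp only [Matrix.mulVec, dotProduct]
  rw [Finset.sum_comm]
  simp [labelMatrix]

theorem portMatrix_mulVec [DecidableEq Q] [Fintype V] [DecidableEq V]
    (A : Attachment C V E U L D) (a : V → ZMod 2) (q : Q) :
    A.portMatrix.mulVec a q = if h : q ∈ L then a (A.port ⟨q, h⟩) else 0 := by
  by_cases h : q ∈ L <;> simp [Matrix.mulVec, dotProduct, portMatrix, h]

theorem IsSkipTree.trans_mulVec [DecidableEq V] [Fintype V] [Fintype E] [NeZero D]
    {A : Attachment C V E U L D} (hT : A.IsSkipTree) (a : V → ZMod 2) (j : ZMod D) :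
    A.trans.mulVec (A.graph.inc.mulVec a) j = a (A.toricPort j) + a (A.toricPort (j + 1)) := by
  rw [Matrix.mulVec_mulVec, hT.basis_change, ← Matrix.mulVec_mulVec, cyc_mulVec,
    labelMatrix_transpose_mulVec, labelMatrix_transpose_mulVec]

theorem IsSkipTree.card_le [DecidableEq V] [Fintype V] [Fintype E] [NeZero D]
    {A : Attachment C V E U L D} (hT : A.IsSkipTree) : L.card ≤ D := by
  have hle : Set.encard (Set.range A.port) ≤ Set.encard (Set.range A.toricPort) :=
    Set.encard_le_encard hT.port_subset
  rw [← Set.image_univ, ← Set.image_univ, A.port.injective.encard_image,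
    A.toricPort.injective.encard_image] at hle
  simpa using hle

variable [DecidableEq Q] [Fintype Q] [Fintype C] [DecidableEq V] [Fintype V]
  [Fintype E] [Fintype U] {A : Attachment C V E U L D} {S : Matrix C Q (ZMod 2)} {w : ℕ}

theorem Desiderata.cycles_mul_inc (hA : A.Desiderata S w) : A.cycles * A.graph.inc = 0 := by
  ext c v
  have : A.cycles c ∈ LinearMap.ker A.graph.inc.vecMulLinear := by
    rw [← hA.cycles_span]; exact Submodule.subset_span ⟨c, rfl⟩
  exact congrFun (LinearMap.mem_ker.1 this) v

theorem Desiderata.exists_vecMul_cycles (hA : A.Desiderata S w) {x : E → ZMod 2}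
    (hx : Matrix.vecMul x A.graph.inc = 0) : ∃ n, Matrix.vecMul n A.cycles = x := by
  have : x ∈ Submodule.span (ZMod 2) (Set.range A.cycles) := by
    rw [hA.cycles_span]; exact hx
  obtain ⟨n, hn⟩ := (Submodule.mem_span_range_iff_exists_fun _).1 this
  exact ⟨n, by rw [← hn, Matrix.vecMul_eq_sum]⟩

/-- The coboundaries are the annihilator of the cycle space, which the rows of N generate. -/
theorem Desiderata.exists_inc_mulVec (hA : A.Desiderata S w) {z : E → ZMod 2}
    (hz : A.cycles.mulVec z = 0) : ∃ a, A.graph.inc.mulVec a = z := by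
  refine exists_mulVec_eq_of_forall_vecMul _ _ fun y hy => ?_
  obtain ⟨n, rfl⟩ := hA.exists_vecMul_cycles hy
  rw [← Matrix.dotProduct_mulVec, hz, dotProduct_zero]

variable [NeZero D]

/-- An operator commuting with the cycle checks and the toric checks acts on the edges as a product
of vertex checks, chosen such that it also clears the homology class of the toric part. -/
theorem exists_vertex_set (hA : A.Desiderata S w) (hT : A.IsSkipTree) {z : E → ZMod 2}
    {p q : ZMod D → ZMod D → ZMod 2} (hz : A.cycles.mulVec z = 0)
    (h : ∀ i j, p i j + p i (j + 1) + q i j + q (i - 1) j +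
      (if i = 0 then A.trans.mulVec z j else 0) = 0) :
    ∃ a, A.graph.inc.mulVec a = z ∧ ∀ j, ∑ i, p i j = a (A.toricPort j) := by
  obtain ⟨a, rfl⟩ := hA.exists_inc_mulVec hz
  -- In the sum of the toric conditions over all layers, `q` cancels and T G a contributes the
  -- values of `a` at labels j and j + 1, so `s` is constant. Constants lie in the kernel of G,
  -- hence `a` may be shifted by `s 0`.
  let s : ZMod D → ZMod 2 := fun j => ∑ i, p i j + a (A.toricPort j)
  have hs : ∀ j, s (j + 1) = s j := by
    intro j
    have h0 := Finset.sum_congr rfl fun i (_ : i ∈ Finset.univ) => h i j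
    simp only [Finset.sum_add_distrib, Finset.sum_const_zero, Finset.sum_ite_eq', Finset.mem_univ,
      if_true, hT.trans_mulVec] at h0
    rw [show ∑ i : ZMod D, q (i - 1) j = ∑ i, q i j from
      Equiv.sum_comp (Equiv.subRight (1 : ZMod D)) (fun i => q i j)] at h0
    have e := CharTwo.add_self_eq_zero (∑ i, q i j)
    have e' := CharTwo.add_self_eq_zero (s j)
    simp only [s] at e' ⊢
    linear_combination h0 - e - e'
  refine ⟨a + fun _ => s 0, ?_, fun j => ?_⟩
  · rw [Matrix.mulVec_add, A.graph.inc_mulVec_const, add_zero]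
  · have h1 : s j = s 0 := eq_of_shift_eq s hs j 0
    have e := CharTwo.add_self_eq_zero (a (A.toricPort j))
    simp only [Pi.add_apply, ← h1, s]
    linear_combination -e

/-- An operator on the edges and a homologically trivial part of the toric code that commutes with
the vertex checks and the toric checks is a product of cycle checks and toric checks. -/
theorem exists_cycle_toric_checks (hA : A.Desiderata S w) (hT : A.IsSkipTree) {x : E → ZMod 2}
    {p q : ZMod D → ZMod D → ZMod 2}
    (hx : ∀ v, Matrix.vecMul x A.graph.inc v + A.labelMatrix.mulVec (p 0) v = 0)
    (h : ∀ i j, q i j + q i (j - 1) + p i j + p (i + 1) j = 0) (hq : ∀ j, ∑ i, q i j = 0) :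
    ∃ (t : ZMod D → ZMod D → ZMod 2) (n : U → ZMod 2),
      (∀ i j, p i j = t i j + t i (j - 1)) ∧ (∀ i j, q i j = t i j + t (i + 1) j) ∧
      x = Matrix.vecMul n A.cycles + Matrix.vecMul (t 0) A.trans := by
  -- Summed over all vertices, the edge part drops out because every edge has two ends.
  have hp0 : ∑ j, p 0 j = 0 := by
    have h0 := Finset.sum_congr rfl fun v (_ : v ∈ Finset.univ) => hx v
    rw [Finset.sum_add_distrib, sum_labelMatrix_mulVec] at h0
    have h1 : ∑ v, Matrix.vecMul x A.graph.inc v = 0 := by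
      have := Matrix.dotProduct_mulVec x A.graph.inc (fun _ => 1)
      rw [A.graph.inc_mulVec_const, dotProduct_zero] at this
      simpa [dotProduct] using this.symm
    simpa [h1] using h0
  -- Summing the toric conditions of one layer over `j` cancels `q` and carries the vanishing sum to
  -- the next layer.
  have hp : ∀ i, ∑ j, p i j = 0 := by
    intro i
    rw [← hp0]
    refine eq_of_shift_eq (fun i => ∑ j, p i j) (fun i => ?_) i 0
    have h0 := Finset.sum_congr rfl fun j (_ : j ∈ Finset.univ) => h i j
    simp only [Finset.sum_add_distrib, Finset.sum_const_zero] at h0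
    rw [show ∑ j : ZMod D, q i (j - 1) = ∑ j, q i j from
      Equiv.sum_comp (Equiv.subRight (1 : ZMod D)) (fun j => q i j)] at h0
    have e := CharTwo.add_self_eq_zero (∑ j, q i j)
    have e' := CharTwo.add_self_eq_zero (∑ j, p i j)
    linear_combination h0 - e - e'
  obtain ⟨t, h1, h2⟩ := exists_toric_primitive p q h hq hp
  -- T G = H_C Pᵀ turns the toric checks of layer 0 into the boundary that `x` lacks; the corrected
  -- edge set is a cycle.
  have hc : Matrix.vecMul (x + Matrix.vecMul (t 0) A.trans) A.graph.inc = 0 := by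
    rw [Matrix.add_vecMul, Matrix.vecMul_vecMul, hT.basis_change, ← Matrix.vecMul_vecMul,
      Matrix.vecMul_transpose]
    funext v
    have : Matrix.vecMul (t 0) (cyc D) = p 0 := by
      funext j; rw [vecMul_cyc, h1]
    rw [this]
    exact hx v
  obtain ⟨n, hn⟩ := hA.exists_vecMul_cycles hc
  refine ⟨t, n, h1, h2, ?_⟩
  rw [hn, add_assoc, add_self_fun, add_zero]

end Attachment

/-! ### The checks of the merged code, in coordinates -/

section Toric

theorem Attachment.sum_mul_onLayer_labelMatrix {D : ℕ} {C V E U Q : Type*} {L : Finset Q}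
    [Fintype V] [DecidableEq V] (A : Attachment C V E U L D) (a : V → ZMod 2) (c k l : ZMod D) :
    ∑ v, a v * onLayer c (A.labelMatrix v) (k, l) = if k = c then a (A.toricPort l) else 0 := by
  split_ifs with h
  · refine Eq.trans ?_ (A.vecMul_labelMatrix a l)
    simp [onLayer, h, Matrix.vecMul, dotProduct]
  · simp [onLayer, h]

variable {D : ℕ} [NeZero D]

theorem onLayer_dotProduct (i : ZMod D) (u : ZMod D → ZMod 2) (z : ZMod D × ZMod D → ZMod 2) :
    onLayer i u ⬝ᵥ z = u ⬝ᵥ fun j => z (i, j) := by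
  simp only [dotProduct, onLayer, Fintype.sum_prod_type, ite_mul, zero_mul]
  rw [Finset.sum_comm]
  simp

theorem toricXPrimal_dotProduct (i j : ZMod D) (z : ZMod D × ZMod D → ZMod 2) :
    toricXPrimal i j ⬝ᵥ z = z (i, j) + z (i, j + 1) := by
  rw [toricXPrimal, onLayer_dotProduct, cyc_apply, add_dotProduct]
  simp

theorem toricXDual_dotProduct (i j : ZMod D) (z : ZMod D × ZMod D → ZMod 2) :
    toricXDual i j ⬝ᵥ z = z (i, j) + z (i - 1, j) := by
  rw [toricXDual, add_dotProduct, onLayer_dotProduct, onLayer_dotProduct]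
  simp

theorem toricZPrimal_dotProduct (i j : ZMod D) (z : ZMod D × ZMod D → ZMod 2) :
    toricZPrimal i j ⬝ᵥ z = z (i, j) + z (i + 1, j) := by
  rw [toricZPrimal, add_dotProduct, onLayer_dotProduct, onLayer_dotProduct]
  simp

theorem toricZDual_dotProduct (i j : ZMod D) (z : ZMod D × ZMod D → ZMod 2) :
    toricZDual i j ⬝ᵥ z = z (i, j) + z (i, j - 1) := by
  rw [toricZDual, onLayer_dotProduct, cyc_transpose_apply, add_dotProduct]
  simp

theorem sum_mul_onLayer (t : ZMod D → ZMod D → ZMod 2) (u : ZMod D → ZMod D → ZMod 2)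
    (c k l : ZMod D) :
    ∑ i, ∑ j, t i j * onLayer (i + c) (u j) (k, l) = ∑ j, t (k - c) j * u j l := by
  rw [Finset.sum_eq_single (k - c)]
  · simp [onLayer]
  · intro i _ hi
    have : k ≠ i + c := fun h => hi (by rw [h, add_sub_cancel_right])
    simp [onLayer, this]
  · simp

theorem sum_mul_toricXPrimal (t : ZMod D → ZMod D → ZMod 2) (k l : ZMod D) :
    ∑ i, ∑ j, t i j * toricXPrimal i j (k, l) = t k l + t k (l - 1) := by
  have h := sum_mul_onLayer t (cyc D) 0 k l
  simp only [add_zero, sub_zero] at h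
  rw [← vecMul_cyc]
  exact h

theorem sum_mul_toricZDual (t : ZMod D → ZMod D → ZMod 2) (k l : ZMod D) :
    ∑ i, ∑ j, t i j * toricZDual i j (k, l) = t k l + t k (l + 1) := by
  have h := sum_mul_onLayer t (cyc D).transpose 0 k l
  simp only [add_zero, sub_zero] at h
  rw [← cyc_mulVec, ← Matrix.vecMul_transpose]
  exact h

theorem sum_mul_toricXDual (t : ZMod D → ZMod D → ZMod 2) (k l : ZMod D) :
    ∑ i, ∑ j, t i j * toricXDual i j (k, l) = t k l + t (k + 1) l := by
  have h := sum_mul_onLayer t (fun j => Pi.single j 1) 0 k l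
  have h' := sum_mul_onLayer t (fun j => Pi.single j 1) (-1) k l
  simp only [add_zero, sub_zero, ← sub_eq_add_neg, sub_neg_eq_add] at h h'
  simp only [toricXDual, Pi.add_apply, mul_add, Finset.sum_add_distrib, h, h']
  simp [Pi.single_apply]

theorem sum_mul_toricZPrimal (t : ZMod D → ZMod D → ZMod 2) (k l : ZMod D) :
    ∑ i, ∑ j, t i j * toricZPrimal i j (k, l) = t k l + t (k - 1) l := by
  have h := sum_mul_onLayer t (fun j => Pi.single j 1) 0 k l
  have h' := sum_mul_onLayer t (fun j => Pi.single j 1) 1 k l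
  simp only [add_zero, sub_zero] at h
  simp only [toricZPrimal, Pi.add_apply, mul_add, Finset.sum_add_distrib, h, h']
  simp [Pi.single_apply]

theorem sum_mul_ite_layer {E : Type*} (t : ZMod D → ZMod D → ZMod 2)
    (M : ZMod D → E → ZMod 2) (c : ZMod D) (e : E) :
    ∑ i, ∑ j, t i j * (if i = c then M j else 0) e = ∑ j, t c j * M j e := by
  rw [Finset.sum_eq_single c]
  · simp
  · intro i _ hi
    simp [hi]
  · simp

end Toric

theorem zero_eq_assemble {Q EZ EX : Type*} {D : ℕ} :
    (0 : MergedQubit Q EZ EX D → ZMod 2) = assemble 0 0 0 0 0 := by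
  ext (_ | _ | _ | _ | _) <;> rfl

theorem exists_eq_assemble {Q EZ EX : Type*} {D : ℕ} (f : MergedQubit Q EZ EX D → ZMod 2) :
    ∃ q z x p r, f = assemble q z x p r :=
  ⟨fun i => f (.inl i), fun i => f (.inr (.inl i)), fun i => f (.inr (.inr (.inl i))),
    fun i => f (.inr (.inr (.inr (.inl i)))), fun i => f (.inr (.inr (.inr (.inr i)))), by
      ext (_ | _ | _ | _ | _) <;> rfl⟩

theorem assemble_add {Q EZ EX : Type*} {D : ℕ} (q q' : Q → ZMod 2) (z z' : EZ → ZMod 2)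
    (x x' : EX → ZMod 2) (p p' r r' : ZMod D × ZMod D → ZMod 2) :
    assemble q z x p r + assemble q' z' x' p' r' =
      assemble (q + q') (z + z') (x + x') (p + p') (r + r') := by
  ext (_ | _ | _ | _ | _) <;> rfl

section Merged

variable {Q C VZ EZ UZ VX EX UX : Type*} {D : ℕ} [NeZero D]
  {LZ LX : Finset Q}

theorem commutes_assemble [Fintype Q] [Fintype EZ] [Fintype EX] (q q' : Q → ZMod 2)
    (z z' : EZ → ZMod 2) (x x' : EX → ZMod 2) (p p' r r' : ZMod D × ZMod D → ZMod 2)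
    (q₂ q₂' : Q → ZMod 2) (z₂ z₂' : EZ → ZMod 2)
    (x₂ x₂' : EX → ZMod 2) (p₂ p₂' r₂ r₂' : ZMod D × ZMod D → ZMod 2) :
    Commutes (assemble q z x p r, assemble q' z' x' p' r')
        (assemble q₂ z₂ x₂ p₂ r₂, assemble q₂' z₂' x₂' p₂' r₂') ↔
      (q ⬝ᵥ q₂' + q' ⬝ᵥ q₂) + (z ⬝ᵥ z₂' + z' ⬝ᵥ z₂) + (x ⬝ᵥ x₂' + x' ⬝ᵥ x₂) +
        (p ⬝ᵥ p₂' + p' ⬝ᵥ p₂) + (r ⬝ᵥ r₂' + r' ⬝ᵥ r₂) = 0 := by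
  have h : ∀ (q q' : Q → ZMod 2) (z z' : EZ → ZMod 2)
      (x x' : EX → ZMod 2) (p p' r r' : ZMod D × ZMod D → ZMod 2),
      assemble q z x p r ⬝ᵥ assemble q' z' x' p' r' =
        q ⬝ᵥ q' + z ⬝ᵥ z' + x ⬝ᵥ x' + p ⬝ᵥ p' + r ⬝ᵥ r' := by
    intros
    simp [dotProduct, assemble, Fintype.sum_sum_type, add_assoc]
  simp only [Commutes, h]
  refine Eq.congr ?_ rfl
  ring

variable [DecidableEq Q] [DecidableEq VZ] [DecidableEq VX]

variable (H : C → Pauli Q) (AZ : Attachment C VZ EZ UZ LZ D) (AX : Attachment C VX EX UX LX D)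

/-- The conditions for commuting with all checks of the merged code, in coordinates. -/
theorem commutes_mergedCode_iff [Fintype Q] [Fintype EZ] [Fintype EX] (xQ zQ : Q → ZMod 2)
    (xZ zZ : EZ → ZMod 2) (xX zX : EX → ZMod 2)
    (xP zP xD zD : ZMod D × ZMod D → ZMod 2) :
    (∀ c, Commutes (mergedCode H AZ AX c)
        (assemble xQ xZ xX xP xD, assemble zQ zZ zX zP zD)) ↔
      (∀ s, (H s).1 ⬝ᵥ zQ + (H s).2 ⬝ᵥ xQ + AZ.matching s ⬝ᵥ zZ + AX.matching s ⬝ᵥ xX = 0) ∧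
      AZ.cycles.mulVec zZ = 0 ∧ AX.cycles.mulVec xX = 0 ∧
      (∀ v, Matrix.vecMul xQ AZ.portMatrix v + Matrix.vecMul xZ AZ.graph.inc v +
        AZ.labelMatrix.mulVec (fun j => xP (0, j)) v = 0) ∧
      (∀ v, Matrix.vecMul zQ AX.portMatrix v + Matrix.vecMul zX AX.graph.inc v +
        AX.labelMatrix.mulVec (fun j => zD (-1, j)) v = 0) ∧
      (∀ i j, zP (i, j) + zP (i, j + 1) + zD (i, j) + zD (i - 1, j) +
        (if i = 0 then AZ.trans.mulVec zZ j else 0) = 0) ∧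
      (∀ i j, xD (i, j) + xD (i, j - 1) + xP (i, j) + xP (i + 1, j) +
        (if i = -1 then AX.trans.mulVec xX (j - 1) else 0) = 0) := by
  simp only [Sum.forall, Prod.forall, mergedCode, zero_eq_assemble, commutes_assemble,
    zero_dotProduct, add_zero, zero_add, onLayer_dotProduct, toricXPrimal_dotProduct,
    toricXDual_dotProduct, toricZPrimal_dotProduct, toricZDual_dotProduct]
  refine and_congr Iff.rfl (and_congr ?_ (and_congr ?_ (and_congr ?_ (and_congr ?_
    (and_congr ?_ ?_)))))
  · exact funext_iff.symm
  · exact funext_iff.symm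
  · refine forall_congr' fun v => Eq.congr ?_ rfl
    rw [dotProduct_comm, dotProduct_comm (fun e => AZ.graph.inc e v)]
    rfl
  · refine forall_congr' fun v => Eq.congr ?_ rfl
    rw [dotProduct_comm, dotProduct_comm (fun e => AX.graph.inc e v)]
    rfl
  · refine forall₂_congr fun i j => Eq.congr ?_ rfl
    split_ifs
    · simp only [Matrix.mulVec]; ring
    · simp only [zero_dotProduct]; ring
  · refine forall₂_congr fun i j => Eq.congr ?_ rfl
    split_ifs
    · simp only [Matrix.mulVec]; ring
    · simp only [zero_dotProduct]; ring

variable [Fintype VZ] [Fintype VX] [Fintype C] [Fintype UZ] [Fintype UX]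

/-- The product of the checks of the merged code with the given exponents, in coordinates. -/
def checkProduct (c : C → ZMod 2) (nZ : UZ → ZMod 2) (nX : UX → ZMod 2) (a : VZ → ZMod 2)
    (b : VX → ZMod 2) (t t' : ZMod D → ZMod D → ZMod 2) : Pauli (MergedQubit Q EZ EX D) :=
  (assemble ((∑ s, c s • H s).1 + AX.portMatrix.mulVec b)
      (Matrix.vecMul c AZ.matching + Matrix.vecMul nZ AZ.cycles + Matrix.vecMul (t 0) AZ.trans)
      (AX.graph.inc.mulVec b)
      (fun k => t k.1 k.2 + t k.1 (k.2 - 1))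
      (fun k => t k.1 k.2 + t (k.1 + 1) k.2 + if k.1 = -1 then b (AX.toricPort k.2) else 0),
    assemble ((∑ s, c s • H s).2 + AZ.portMatrix.mulVec a)
      (AZ.graph.inc.mulVec a)
      (Matrix.vecMul c AX.matching + Matrix.vecMul nX AX.cycles +
        Matrix.vecMul (fun j => t' (-1) (j + 1)) AX.trans)
      (fun k => t' k.1 k.2 + t' (k.1 - 1) k.2 + if k.1 = 0 then a (AZ.toricPort k.2) else 0)
      (fun k => t' k.1 k.2 + t' k.1 (k.2 + 1)))

theorem checkProduct_eq_sum (k : MergedCheck C UZ UX VZ VX D → ZMod 2) :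
    ∑ i, k i • mergedCode H AZ AX i =
      checkProduct H AZ AX (fun s => k (.inl s)) (fun u => k (.inr (.inl u)))
        (fun u => k (.inr (.inr (.inl u)))) (fun v => k (.inr (.inr (.inr (.inl v)))))
        (fun v => k (.inr (.inr (.inr (.inr (.inl v))))))
        (fun i j => k (.inr (.inr (.inr (.inr (.inr (.inl (i, j))))))))
        (fun i j => k (.inr (.inr (.inr (.inr (.inr (.inr (i, j)))))))) := by
  ext (q | e | e | ⟨i, j⟩ | ⟨i, j⟩)
  all_goals
    simp only [Prod.fst_add, Prod.snd_add, Prod.fst_sum, Prod.snd_sum, Prod.smul_fst, Prod.smul_snd,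
      Finset.sum_apply, Pi.smul_apply, smul_eq_mul, Fintype.sum_sum_type, Fintype.sum_prod_type,
      mergedCode, assemble, checkProduct, Sum.elim_inl, Sum.elim_inr, Pi.zero_apply, mul_zero,
      Finset.sum_const_zero, add_zero, zero_add, Pi.add_apply, Matrix.vecMul, Matrix.mulVec,
      dotProduct, sum_mul_toricXPrimal, sum_mul_toricXDual, sum_mul_toricZPrimal,
      sum_mul_toricZDual, Attachment.sum_mul_onLayer_labelMatrix, sum_mul_ite_layer]
  · simp only [mul_comm (AX.portMatrix q _)]
  · rw [← add_assoc]
    exact congrArg (_ + ·) (sum_mul_ite_layer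
      (fun i j => k (.inr (.inr (.inr (.inr (.inr (.inl (i, j)))))))) AZ.trans 0 e)
  · simp only [mul_comm (AX.graph.inc e _)]
  · ring
  · simp only [mul_comm (AZ.portMatrix q _)]
  · simp only [mul_comm (AZ.graph.inc e _)]
  -- Reindexing by one, since check `j` of the last Z-layer carries row `j - 1` of T_X.
  · rw [← add_assoc, ← Equiv.sum_comp (Equiv.addRight (1 : ZMod D)) fun j =>
      k (.inr (.inr (.inr (.inr (.inr (.inr (-1, j))))))) * AX.trans (j - 1) e]
    simp
  · ring

theorem checkProduct_mem_span (c : C → ZMod 2) (nZ : UZ → ZMod 2) (nX : UX → ZMod 2)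
    (a : VZ → ZMod 2) (b : VX → ZMod 2) (t t' : ZMod D → ZMod D → ZMod 2) :
    checkProduct H AZ AX c nZ nX a b t t' ∈
      Submodule.span (ZMod 2) (Set.range (mergedCode H AZ AX)) :=
  (Submodule.mem_span_range_iff_exists_fun _).2
    ⟨Sum.elim c (Sum.elim nZ (Sum.elim nX (Sum.elim a (Sum.elim b
      (Sum.elim (fun k => t k.1 k.2) fun k => t' k.1 k.2))))), checkProduct_eq_sum H AZ AX _⟩

theorem exists_eq_checkProduct {A : Pauli (MergedQubit Q EZ EX D)}
    (hA : A ∈ Submodule.span (ZMod 2) (Set.range (mergedCode H AZ AX))) :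
    ∃ c nZ nX a b t t', A = checkProduct H AZ AX c nZ nX a b t t' := by
  obtain ⟨k, rfl⟩ := (Submodule.mem_span_range_iff_exists_fun _).1 hA
  exact ⟨_, _, _, _, _, _, _, checkProduct_eq_sum H AZ AX k⟩

end Merged

/-! ### Commutation with products of checks -/

section Commutation

variable {Q : Type*} [Fintype Q]

theorem Commutes.symm {A B : Pauli Q} (h : Commutes A B) : Commutes B A := by
  unfold Commutes at *
  rw [dotProduct_comm, dotProduct_comm B.2, add_comm]
  exact h

theorem Commutes.add_right {A B B' : Pauli Q} (h : Commutes A B) (h' : Commutes A B') :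
    Commutes A (B + B') := by
  unfold Commutes at *
  simp only [Prod.fst_add, Prod.snd_add, dotProduct_add]
  linear_combination h + h'

theorem commutes_of_mem_span {C : Type*} {H : C → Pauli Q} {A B : Pauli Q}
    (hA : ∀ c, Commutes A (H c)) (hB : B ∈ Submodule.span (ZMod 2) (Set.range H)) :
    Commutes A B := by
  induction hB using Submodule.span_induction with
  | mem x hx => obtain ⟨c, rfl⟩ := hx; exact hA c
  | zero => simp [Commutes]
  | add x y _ _ hx hy => exact hx.add_right hy
  | smul r x _ hx =>
    unfold Commutes at *
    simp only [Prod.smul_fst, Prod.smul_snd, dotProduct_smul, ← smul_add, hx, smul_zero]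

/-- Multiplication by a product of checks preserves nontrivial logical operators. -/
theorem IsNontrivialLogical.add_mem_span {C : Type*} {H : C → Pauli Q} (hH : IsStabilizerCode H)
    {A B : Pauli Q} (hA : IsNontrivialLogical H A)
    (hB : B ∈ Submodule.span (ZMod 2) (Set.range H)) : IsNontrivialLogical H (A + B) :=
  ⟨fun c => (hA.1 c).add_right (commutes_of_mem_span (hH c) hB),
    fun h => hA.2 ((Submodule.add_mem_iff_left _ hB).1 h)⟩

end Commutation

/-! ### Toric boundary relations and identities at the attachments -/

section Toric

variable {D : ℕ}

theorem toricXPrimal_apply (i j k l : ZMod D) : toricXPrimal i j (k, l) =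
    if k = i then (if l = j then 1 else 0) + (if l - 1 = j then 1 else 0) else 0 := by
  simp only [toricXPrimal, onLayer, cyc_apply, Pi.add_apply, Pi.single_apply, sub_eq_iff_eq_add]

theorem toricXDual_apply (i j k l : ZMod D) : toricXDual i j (k, l) =
    if l = j then (if k = i then 1 else 0) + (if k + 1 = i then 1 else 0) else 0 := by
  simp only [toricXDual, onLayer, Pi.add_apply, Pi.single_apply, eq_sub_iff_add_eq]
  split_ifs <;> rfl

theorem toricZPrimal_apply (i j k l : ZMod D) : toricZPrimal i j (k, l) =
    if l = j then (if k = i then 1 else 0) + (if k - 1 = i then 1 else 0) else 0 := by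
  simp only [toricZPrimal, onLayer, Pi.add_apply, Pi.single_apply, sub_eq_iff_eq_add]
  split_ifs <;> rfl

theorem toricZDual_apply (i j k l : ZMod D) : toricZDual i j (k, l) =
    if k = i then (if l = j then 1 else 0) + (if l + 1 = j then 1 else 0) else 0 := by
  simp only [toricZDual, onLayer, cyc_transpose_apply, Pi.add_apply, Pi.single_apply,
    eq_sub_iff_add_eq]

theorem toricX_boundary (i j k l : ZMod D) :
    toricXDual i j (k, l) + toricXDual i j (k, l - 1) + toricXPrimal i j (k, l) +
      toricXPrimal i j (k + 1, l) = 0 := by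
  simp only [toricXDual_apply, toricXPrimal_apply]
  split_ifs <;> decide

theorem toricZ_boundary (i j k l : ZMod D) :
    toricZPrimal i j (k, l) + toricZPrimal i j (k, l + 1) + toricZDual i j (k, l) +
      toricZDual i j (k - 1, l) = 0 := by
  simp only [toricZDual_apply, toricZPrimal_apply]
  split_ifs <;> decide

end Toric

namespace Attachment

variable {C V E U Q : Type*} {L : Finset Q} {D : ℕ} [DecidableEq V] {A : Attachment C V E U L D}

theorem inc_mulVec_single [Fintype V] (v : V) :
    A.graph.inc.mulVec (Pi.single v 1) = fun e => A.graph.inc e v := by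
  ext e; simp

theorem dotProduct_portMatrix_of_disjoint [Fintype Q] [DecidableEq Q] {V' : Type*} [DecidableEq V']
    {E' U' : Type*} {L' : Finset Q} {A' : Attachment C V' E' U' L' D} (h : Disjoint L L')
    (v : V) (v' : V') :
    ∑ q, A.portMatrix q v * A'.portMatrix q v' = 0 := by
  refine Finset.sum_eq_zero fun q _ => ?_
  by_cases hq : q ∈ L
  · have : q ∉ L' := Finset.disjoint_left.1 h hq
    simp [portMatrix, this]
  · simp [portMatrix, hq]

variable [NeZero D]

theorem labelMatrix_mulVec_cyc (v : V) (j : ZMod D) :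
    A.labelMatrix.mulVec (cyc D j) v = A.labelMatrix v j + A.labelMatrix v (j + 1) := by
  rw [cyc_apply, Matrix.mulVec_add]
  simp

variable [Fintype V] [Fintype E]

theorem IsSkipTree.trans_mulVec_inc (hT : A.IsSkipTree) (v : V) (j : ZMod D) :
    A.trans.mulVec (fun e => A.graph.inc e v) j = A.labelMatrix v j + A.labelMatrix v (j + 1) := by
  rw [← inc_mulVec_single, hT.trans_mulVec]
  simp [labelMatrix, Pi.single_apply]

theorem IsSkipTree.trans_vecMul_inc (hT : A.IsSkipTree) (v : V) (j : ZMod D) :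
    Matrix.vecMul (A.trans j) A.graph.inc v = A.labelMatrix v j + A.labelMatrix v (j + 1) := by
  rw [← hT.trans_mulVec_inc]
  rfl

theorem IsSkipTree.trans_vecMul_inc_add (hT : A.IsSkipTree) (v : V) (j : ZMod D) :
    Matrix.vecMul (A.trans j) A.graph.inc v + A.labelMatrix.mulVec (cyc D j) v = 0 := by
  rw [hT.trans_vecMul_inc, labelMatrix_mulVec_cyc, CharTwo.add_self_eq_zero]

end Attachment

/-! ### The merged checks commute -/

section Stabilizer

variable {Q C VZ EZ UZ VX EX UX : Type*}
    [Fintype Q] [DecidableEq Q] [Fintype C]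
    [Fintype VZ] [DecidableEq VZ] [Fintype EZ] [Fintype UZ]
    [Fintype VX] [DecidableEq VX] [Fintype EX] [Fintype UX]
    {w D : ℕ} [NeZero D] {H : C → Pauli Q}
    {LZ LX : Finset Q}
    {AZ : Attachment C VZ EZ UZ LZ D} {AX : Attachment C VX EX UX LX D}

theorem isStabilizerCode_mergedCode (hH : IsStabilizerCode H) (hdisj : Disjoint LZ LX)
    (hAZ : AZ.Desiderata (Matrix.of fun s => (H s).1) w)
    (hAX : AX.Desiderata (Matrix.of fun s => (H s).2) w)
    (hTZ : AZ.IsSkipTree) (hTX : AX.IsSkipTree) :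
    IsStabilizerCode (mergedCode H AZ AX) := by
  have hMZ : ∀ s v, Matrix.vecMul (H s).1 AZ.portMatrix v +
      Matrix.vecMul (AZ.matching s) AZ.graph.inc v = 0 := fun s v => by
    rw [CharTwo.add_eq_zero]
    exact (congrFun (congrFun hAZ.matching_boundary s) v).symm
  have hMX : ∀ s v, Matrix.vecMul (H s).2 AX.portMatrix v +
      Matrix.vecMul (AX.matching s) AX.graph.inc v = 0 := fun s v => by
    rw [CharTwo.add_eq_zero]
    exact (congrFun (congrFun hAX.matching_boundary s) v).symm
  have hNZ : ∀ u v, Matrix.vecMul (AZ.cycles u) AZ.graph.inc v = 0 := fun u v =>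
    congrFun (congrFun hAZ.cycles_mul_inc u) v
  have hNX : ∀ u v, Matrix.vecMul (AX.cycles u) AX.graph.inc v = 0 := fun u v =>
    congrFun (congrFun hAX.cycles_mul_inc u) v
  suffices ∀ b B, mergedCode H AZ AX b = B → ∀ a, Commutes (mergedCode H AZ AX a) B from
    fun a b => this b _ rfl a
  rintro (s | u | u | v | v | ⟨i, j⟩ | ⟨i, j⟩) B hB
  all_goals
    simp only [mergedCode, zero_eq_assemble] at hB
    subst hB
    rw [commutes_mergedCode_iff]
    simp only [dotProduct_zero, Matrix.mulVec_zero, Matrix.zero_vecMul, Pi.zero_apply, add_zero,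
      zero_add, ite_self, implies_true, and_true, true_and, ← Pi.zero_def]
  · exact ⟨fun s' => hH s' s, hMZ s, hMX s⟩
  · exact hNZ u
  · exact hNX u
  · refine ⟨fun s => hMZ s v, funext fun u => hNZ u v, fun u => ?_, fun i j => ?_⟩
    -- A vertex check of G_Z and one of G_X could meet only in an original qubit of both supports.
    · exact Attachment.dotProduct_portMatrix_of_disjoint hdisj v u
    · rw [hTZ.trans_mulVec_inc]
      by_cases hi : i = 0 <;> simp [onLayer, hi, CharTwo.add_self_eq_zero]
  · refine ⟨fun s => hMX s v, funext fun u => hNX u v, fun u => ?_, fun i j => ?_⟩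
    · exact Attachment.dotProduct_portMatrix_of_disjoint hdisj.symm v u
    · rw [hTX.trans_mulVec_inc, sub_add_cancel]
      by_cases hi : i = -1
      · simp only [onLayer, hi, if_true]
        linear_combination CharTwo.add_self_eq_zero (AX.labelMatrix v j) +
          CharTwo.add_self_eq_zero (AX.labelMatrix v (j - 1))
      · simp [onLayer, hi]
  · refine ⟨fun v => ?_, toricX_boundary i j⟩
    by_cases hi : i = 0
    · simpa [hi, toricXPrimal, onLayer] using hTZ.trans_vecMul_inc_add v j
    · simp only [toricXPrimal, onLayer, if_neg hi, if_neg (Ne.symm hi), Matrix.zero_vecMul]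
      exact (zero_add _).trans (congrFun (Matrix.mulVec_zero _) v)
  · refine ⟨fun v => ?_, toricZ_boundary i j⟩
    by_cases hi : i = -1
    · have := hTX.trans_vecMul_inc_add v (j - 1)
      rw [cyc_apply, sub_add_cancel, add_comm (Pi.single _ _), ← cyc_transpose_apply] at this
      simp only [toricZDual, onLayer, hi, if_true]
      exact this
    · simp only [toricZDual, onLayer, if_neg hi, if_neg (Ne.symm hi), Matrix.zero_vecMul]
      exact (zero_add _).trans (congrFun (Matrix.mulVec_zero _) v)

end Stabilizer

/-! ### Weights, and the cost of cleaning -/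

section Weight

variable {Q : Type*} [Fintype Q]

theorem weight_xOp [DecidableEq Q] (S : Finset Q) : weight (xOp S) = S.card := by
  simp [weight, xOp]

theorem weight_zOp [DecidableEq Q] (S : Finset Q) : weight (zOp S) = S.card := by
  simp [weight, zOp]

theorem weight_assemble {EZ EX : Type*} [Fintype EZ] [Fintype EX] {D : ℕ} [NeZero D]
    (q q' : Q → ZMod 2) (z z' : EZ → ZMod 2) (x x' : EX → ZMod 2)
    (p p' r r' : ZMod D × ZMod D → ZMod 2) :
    weight (assemble q z x p r, assemble q' z' x' p' r') =
      weight (q, q') + (weight (z, z') + (weight (x, x') + (weight (p, p') + weight (r, r')))) := by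
  simp only [weight]
  simp only [Finset.card_filter]
  simp only [Fintype.sum_sum_type]
  rfl

theorem weight_extend {EZ EX : Type*} [Fintype EZ] [Fintype EX] {D : ℕ} [NeZero D] (B : Pauli Q) :
    weight ((assemble B.1 0 0 0 0, assemble B.2 0 0 0 0) : Pauli (MergedQubit Q EZ EX D)) =
      weight B := by
  rw [weight_assemble]
  simp [weight]

theorem weight_add_le (q q' u u' : Q → ZMod 2) : weight (q + u, q' + u') ≤
    weight (q, q') + (Finset.univ.filter fun i => u i ≠ 0).card +
      (Finset.univ.filter fun i => u' i ≠ 0).card := by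
  classical
  refine le_trans (Finset.card_le_card ?_)
    ((Finset.card_union_le _ _).trans (Nat.add_le_add_right (Finset.card_union_le _ _) _))
  intro i
  simp only [Finset.mem_filter, Finset.mem_univ, true_and, Finset.mem_union, Pi.add_apply]
  contrapose!
  rintro ⟨⟨⟨h1, h2⟩, h3⟩, h4⟩
  simp [h1, h2, h3, h4]

theorem card_support_fst_le (q q' : Q → ZMod 2) :
    (Finset.univ.filter fun i => q i ≠ 0).card ≤ weight (q, q') :=
  Finset.card_le_card fun i => by simp +contextual

theorem card_support_snd_le (q q' : Q → ZMod 2) :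
    (Finset.univ.filter fun i => q' i ≠ 0).card ≤ weight (q, q') :=
  Finset.card_le_card fun i => by simp +contextual

/-- Clearing the qubits of `L` is paid for on the toric code. -/
theorem Attachment.card_portMatrix_mulVec_le {C V E U : Type*} {L : Finset Q} {D : ℕ} [NeZero D]
    [DecidableEq Q] [DecidableEq V] [Fintype V] [Fintype E] {A : Attachment C V E U L D}
    (hT : A.IsSkipTree) {a : V → ZMod 2} {z : ZMod D × ZMod D → ZMod 2}
    (h : ∀ j, ∑ i, z (i, j) = a (A.toricPort j)) :
    (Finset.univ.filter fun q => A.portMatrix.mulVec a q ≠ 0).card ≤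
      (Finset.univ.filter fun k => z k ≠ 0).card := by
  -- A changed qubit is related to the toric qubits in the column of its label. The column sum is
  -- nonzero, so one of them is in the support; as the port is injective, no toric qubit is charged
  -- twice.
  refine Finset.card_le_card_of_forall_subsingleton
    (fun q k => ∃ hq : q ∈ L, A.port ⟨q, hq⟩ = A.toricPort k.2) ?_ ?_
  · intro q hq
    simp only [Finset.mem_filter, Finset.mem_univ, true_and, A.portMatrix_mulVec] at hq ⊢
    split_ifs at hq with hqL
    · obtain ⟨j, hj⟩ := hT.port_subset ⟨⟨q, hqL⟩, rfl⟩
      rw [← hj, ← h] at hq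
      obtain ⟨i, -, hi⟩ := Finset.exists_ne_zero_of_sum_ne_zero hq
      exact ⟨(i, j), hi, hqL, hj.symm⟩
    · exact absurd rfl hq
  · rintro k - q ⟨-, hq, e⟩ q' ⟨-, hq', e'⟩
    simpa using A.port.injective (e.trans e'.symm)

theorem Attachment.vecMul_portMatrix_of_disjoint {C V E U : Type*} {L S : Finset Q} {D : ℕ}
    [DecidableEq Q] [DecidableEq V]
    {A : Attachment C V E U L D} (h : Disjoint S L) (v : V) :
    Matrix.vecMul (fun q => if q ∈ S then 1 else 0) A.portMatrix v = 0 := by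
  refine Finset.sum_eq_zero fun q _ => ?_
  by_cases hq : q ∈ S
  · have : q ∉ L := Finset.disjoint_left.1 h hq
    simp [portMatrix, this]
  · simp [hq]

end Weight

/-- The reflection i ↦ -1 - i takes the layer attached to G_X to layer 0 and reverses the order of
layers. With a shift of one index by 1, it lets the lemmas written for the G_Z side serve the G_X
side. -/
theorem sum_neg_one_sub {D : ℕ} [NeZero D] (g : ZMod D → ZMod 2) :
    ∑ i, g (-1 - i) = ∑ i, g i :=
  Equiv.sum_comp (Equiv.subLeft (-1 : ZMod D)) g

/-! ### Logical operators of the merged code and of the original code -/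

section Distance

variable {Q C VZ EZ UZ VX EX UX : Type*}
    [Fintype Q] [DecidableEq Q] [Fintype C]
    [Fintype VZ] [DecidableEq VZ] [Fintype EZ] [Fintype UZ]
    [Fintype VX] [DecidableEq VX] [Fintype EX] [Fintype UX]
    {w D : ℕ} [NeZero D] {H : C → Pauli Q}
    {LZ LX : Finset Q}
    {AZ : Attachment C VZ EZ UZ LZ D} {AX : Attachment C VX EX UX LX D}

/-- A logical operator of the merged code that acts trivially on the original code and is
homologically trivial on the toric code is a product of checks. -/
theorem mem_span_mergedCode
    (hAZ : AZ.Desiderata (Matrix.of fun s => (H s).1) w)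
    (hAX : AX.Desiderata (Matrix.of fun s => (H s).2) w)
    (hTZ : AZ.IsSkipTree) (hTX : AX.IsSkipTree)
    {xZ : EZ → ZMod 2} {zX : EX → ZMod 2} {xP zP xD zD : ZMod D × ZMod D → ZMod 2}
    (hA : ∀ c, Commutes (mergedCode H AZ AX c)
      (assemble 0 xZ 0 xP xD, assemble 0 0 zX zP zD))
    (hz : ∀ j, ∑ i, zP (i, j) = 0) (hx : ∀ j, ∑ i, xD (i, j) = 0) :
    (assemble 0 xZ 0 xP xD, assemble 0 0 zX zP zD) ∈
      Submodule.span (ZMod 2) (Set.range (mergedCode H AZ AX)) := by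
  obtain ⟨-, -, -, hVZ, hVX, hCX, hCZ⟩ := (commutes_mergedCode_iff H AZ AX _ _ _ _ _ _ _ _ _ _).1 hA
  simp only [Matrix.zero_vecMul, Matrix.mulVec_zero, Pi.zero_apply, zero_add, ite_self,
    add_zero] at hVZ hVX hCX hCZ
  obtain ⟨t, nZ, h1, h2, h3⟩ := Attachment.exists_cycle_toric_checks hAZ hTZ
    (p := fun i j => xP (i, j)) (q := fun i j => xD (i, j)) hVZ hCZ hx
  obtain ⟨t', nX, h4, h5, h6⟩ := Attachment.exists_cycle_toric_checks hAX hTX (x := zX)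
    (p := fun i j => zD (-1 - i, j)) (q := fun i j => zP (-1 - i, j + 1))
    (fun v => by simpa using hVX v)
    (fun i j => by
      have := hCX (-1 - i) j
      rw [sub_add_cancel, show -1 - (i + 1) = -1 - i - 1 by ring]
      linear_combination this)
    (fun j => (sum_neg_one_sub fun i => zP (i, j + 1)).trans (hz _))
  -- The primitive `t'` was found in reflected coordinates; this undoes the reflection and the
  -- shift.
  convert checkProduct_mem_span H AZ AX 0 nZ nX 0 0 t (fun i j => t' (-1 - i) (j - 1)) using 1
  refine Prod.ext ?_ ?_
  · ext (q | e | e | ⟨i, j⟩ | ⟨i, j⟩)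
    · simp [checkProduct, assemble]
    · simp [checkProduct, assemble, h3]
    · simp [checkProduct, assemble]
    · simp [checkProduct, assemble, h1]
    · simp [checkProduct, assemble, h2]
  · ext (q | e | e | ⟨i, j⟩ | ⟨i, j⟩)
    · simp [checkProduct, assemble]
    · simp [checkProduct, assemble]
    · simp [checkProduct, assemble, h6]
    · have := h5 (-1 - i) (j - 1)
      simp only [sub_add_cancel, sub_sub_cancel] at this
      simp [checkProduct, assemble, this, sub_add]
    · have := h4 (-1 - i) j
      simp only [sub_sub_cancel] at this
      simp [checkProduct, assemble, this, add_comm]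

/-- Cleaning by vertex checks: the restriction of the cleaned operator to the original qubits is the
required B. -/
theorem exists_isNontrivialLogical_weight_le (hH : IsStabilizerCode H) (hdisj : Disjoint LZ LX)
    (hAZ : AZ.Desiderata (Matrix.of fun s => (H s).1) w)
    (hAX : AX.Desiderata (Matrix.of fun s => (H s).2) w)
    (hTZ : AZ.IsSkipTree) (hTX : AX.IsSkipTree) {A : Pauli (MergedQubit Q EZ EX D)}
    (hA : IsNontrivialLogical (mergedCode H AZ AX) A) :
    ∃ B, IsNontrivialLogical H B ∧ weight B ≤ weight A := by
  have hmerged := isStabilizerCode_mergedCode hH hdisj hAZ hAX hTZ hTX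
  obtain ⟨x, z⟩ := A
  obtain ⟨xQ, xZ, xX, xP, xD, rfl⟩ := exists_eq_assemble x
  obtain ⟨zQ, zZ, zX, zP, zD, rfl⟩ := exists_eq_assemble z
  obtain ⟨hs, hNZ, hNX, -, -, hCX, hCZ⟩ :=
    (commutes_mergedCode_iff H AZ AX _ _ _ _ _ _ _ _ _ _).1 hA.1
  obtain ⟨a, rfl, hap⟩ := Attachment.exists_vertex_set hAZ hTZ (p := fun i j => zP (i, j))
    (q := fun i j => zD (i, j)) hNZ hCX
  obtain ⟨b, rfl, hbp⟩ := Attachment.exists_vertex_set hAX hTX (p := fun i j => xD (-1 - i, j))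
    (q := fun i j => xP (-1 - i, j + 1)) hNX (fun i j => by
      have := hCZ (-1 - i) (j + 1)
      simp only [add_sub_cancel_right, sub_eq_self] at this
      rw [show -1 - (i - 1) = -1 - i + 1 by ring]
      linear_combination this)
  replace hbp : ∀ j, ∑ i, xD (i, j) = b (AX.toricPort j) := fun j =>
    (sum_neg_one_sub fun i => xD (i, j)).symm.trans (hbp j)
  refine ⟨(xQ + AX.portMatrix.mulVec b, zQ + AZ.portMatrix.mulVec a), ⟨fun s => ?_, fun hB => ?_⟩,
    ?_⟩
  -- By M G = S F, the sign that an extended check picks up on the edges equals the sign of the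
  -- original check on the qubits changed by cleaning.
  · have hMZ : AZ.matching s ⬝ᵥ AZ.graph.inc.mulVec a =
        (H s).1 ⬝ᵥ AZ.portMatrix.mulVec a := by
      rw [Matrix.dotProduct_mulVec, Matrix.dotProduct_mulVec]
      exact congrArg (· ⬝ᵥ a) (congrFun hAZ.matching_boundary s)
    have hMX : AX.matching s ⬝ᵥ AX.graph.inc.mulVec b =
        (H s).2 ⬝ᵥ AX.portMatrix.mulVec b := by
      rw [Matrix.dotProduct_mulVec, Matrix.dotProduct_mulVec]
      exact congrArg (· ⬝ᵥ b) (congrFun hAX.matching_boundary s)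
    have := hs s
    rw [hMZ, hMX] at this
    simp only [Commutes, dotProduct_add]
    linear_combination this
  · obtain ⟨c, hc⟩ := (Submodule.mem_span_range_iff_exists_fun _).1 hB
    -- If B is the product of the checks in `c`, multiplying by their extensions and by the vertex
    -- checks clears the original qubits, while the vertex checks make all column sums vanish.
    have hlog := hA.add_mem_span hmerged (checkProduct_mem_span H AZ AX c 0 0 a b 0 0)
    have eQ : ∀ u v : Q → ZMod 2, u + (u + v + v) = 0 := fun u v => by
      rw [add_assoc, add_self_fun, add_zero, add_self_fun]
    simp only [checkProduct, hc, Prod.mk_add_mk, assemble_add, eQ, add_self_fun] at hlog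
    refine hlog.2 (mem_span_mergedCode hAZ hAX hTZ hTX hlog.1 (fun j => ?_) fun j => ?_)
    · simp [Finset.sum_add_distrib, hap, CharTwo.add_self_eq_zero]
    · simp [Finset.sum_add_distrib, hbp, CharTwo.add_self_eq_zero]
  · rw [weight_assemble]
    have h1 := weight_add_le xQ zQ (AX.portMatrix.mulVec b) (AZ.portMatrix.mulVec a)
    have h2 := Attachment.card_portMatrix_mulVec_le hTX hbp
    have h3 := Attachment.card_portMatrix_mulVec_le hTZ hap
    have h4 := card_support_fst_le xD zD
    have h5 := card_support_snd_le xP zP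
    omega

/-- A nontrivial logical operator of the original code that commutes with the vertex checks is a
nontrivial logical operator of the merged code. -/
theorem IsNontrivialLogical.extend {B : Pauli Q} (hB : IsNontrivialLogical H B)
    (hAZ : AZ.Desiderata (Matrix.of fun s => (H s).1) w)
    (hAX : AX.Desiderata (Matrix.of fun s => (H s).2) w)
    (hx : ∀ v, Matrix.vecMul B.1 AZ.portMatrix v = 0)
    (hz : ∀ v, Matrix.vecMul B.2 AX.portMatrix v = 0) :
    IsNontrivialLogical (mergedCode H AZ AX) (assemble B.1 0 0 0 0, assemble B.2 0 0 0 0) := by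
  refine ⟨?_, fun hmem => hB.2 ?_⟩
  · rw [commutes_mergedCode_iff]
    simp only [dotProduct_zero, Matrix.mulVec_zero, Matrix.zero_vecMul, Pi.zero_apply, add_zero,
      ite_self, implies_true, and_true, ← Pi.zero_def, hx, hz]
    exact hB.1
  · obtain ⟨c, nZ, nX, a, b, t, t', h⟩ := exists_eq_checkProduct H AZ AX hmem
    have hfst := fun q => congrFun (congrArg Prod.fst h) q
    have hsnd := fun q => congrFun (congrArg Prod.snd h) q
    -- No edge is touched, so `a` is constant by connectedness. In column 0 of the primal qubits the
    -- toric Z-checks cancel in the sum over layers, leaving the value of `a` at label 0, which must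
    -- vanish.
    have ha : a = 0 := by
      have hconst := AZ.graph.eq_of_inc_mulVec_eq_zero hAZ.connected
        (funext fun e => (hsnd (.inr (.inl e))).symm)
      have h0 := Finset.sum_congr rfl fun i (_ : i ∈ Finset.univ) =>
        hsnd (.inr (.inr (.inr (.inl (i, 0)))))
      simp only [assemble, checkProduct, Sum.elim_inr, Sum.elim_inl, Pi.zero_apply,
        Finset.sum_const_zero, Finset.sum_add_distrib, Finset.sum_ite_eq', Finset.mem_univ,
        if_true] at h0
      rw [show ∑ i : ZMod D, t' (i - 1) 0 = ∑ i, t' i 0 from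
        Equiv.sum_comp (Equiv.subRight (1 : ZMod D)) (fun i => t' i 0), CharTwo.add_self_eq_zero,
        zero_add] at h0
      funext v
      rw [hconst v, ← h0]; rfl
    have hb : b = 0 := by
      have hconst := AX.graph.eq_of_inc_mulVec_eq_zero hAX.connected
        (funext fun e => (hfst (.inr (.inr (.inl e)))).symm)
      have h0 := Finset.sum_congr rfl fun i (_ : i ∈ Finset.univ) =>
        hfst (.inr (.inr (.inr (.inr (i, 0)))))
      simp only [assemble, checkProduct, Sum.elim_inr, Pi.zero_apply,
        Finset.sum_const_zero, Finset.sum_add_distrib, Finset.sum_ite_eq', Finset.mem_univ,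
        if_true] at h0
      rw [show ∑ i : ZMod D, t (i + 1) 0 = ∑ i, t i 0 from
        Equiv.sum_comp (Equiv.addRight (1 : ZMod D)) (fun i => t i 0), CharTwo.add_self_eq_zero,
        zero_add] at h0
      funext v
      rw [hconst v, ← h0]; rfl
    subst ha hb
    refine (Submodule.mem_span_range_iff_exists_fun _).2
      ⟨c, Prod.ext (funext fun q => ?_) (funext fun q => ?_)⟩
    · simpa [assemble, checkProduct] using (hfst (.inl q)).symm
    · simpa [assemble, checkProduct] using (hsnd (.inl q)).symm

end Distance

end ToricMerge

open ToricMerge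
theorem theorem9
    {Q C VZ EZ UZ VX EX UX : Type*}
    [Fintype Q] [DecidableEq Q] [Fintype C]
    [Fintype VZ] [DecidableEq VZ] [Fintype EZ] [Fintype UZ]
    [Fintype VX] [DecidableEq VX] [Fintype EX] [Fintype UX]
    (w d D : ℕ) [NeZero D]
    (H : C → Pauli Q) (hH : IsStabilizerCode H) (hw : IsLDPC w H) (hd : HasDistance H d)
    (LZ LX : Finset Q) (hdisj : Disjoint LZ LX)
    (hLZ : IsNontrivialLogical H (zOp LZ)) (hLX : IsNontrivialLogical H (xOp LX))
    (AZ : Attachment C VZ EZ UZ LZ D) (AX : Attachment C VX EX UX LX D)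
    (hAZ : AZ.Desiderata (Matrix.of fun s => (H s).1) w)
    (hAX : AX.Desiderata (Matrix.of fun s => (H s).2) w)
    (hTZ : AZ.IsSkipTree) (hTX : AX.IsSkipTree) :
    IsStabilizerCode (mergedCode H AZ AX) ∧
      ∃ d' : ℕ, HasDistance (mergedCode H AZ AX) d' ∧ d ≤ d' ∧
        (D = d ∨ LZ.card = d ∨ LX.card = d → d' = d) := by
  refine ⟨isStabilizerCode_mergedCode hH hdisj hAZ hAX hTZ hTX, ?_⟩
  let S := {n | ∃ A, IsNontrivialLogical (mergedCode H AZ AX) A ∧ weight A = n}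
  have hZ : LZ.card ∈ S := ⟨_, hLZ.extend hAZ hAX (fun v => congrFun (Matrix.zero_vecMul _) v)
    (Attachment.vecMul_portMatrix_of_disjoint hdisj), by rw [weight_extend, weight_zOp]⟩
  have hX : LX.card ∈ S := ⟨_, hLX.extend hAZ hAX
    (Attachment.vecMul_portMatrix_of_disjoint hdisj.symm)
    (fun v => congrFun (Matrix.zero_vecMul _) v), by rw [weight_extend, weight_xOp]⟩
  have hleast : IsLeast S (sInf S) := ⟨Nat.sInf_mem ⟨_, hZ⟩, fun _ hn => Nat.sInf_le hn⟩
  have hle : d ≤ sInf S := by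
    obtain ⟨A, hA, hAw⟩ := hleast.1
    obtain ⟨B, hB, hBw⟩ := exists_isNontrivialLogical_weight_le hH hdisj hAZ hAX hTZ hTX hA
    exact (hd.2 ⟨B, hB, rfl⟩).trans (hBw.trans hAw.le)
  refine ⟨sInf S, hleast, hle, fun h => ?_⟩
  -- In the case D = d the chain d ≤ d' ≤ |L_Z| ≤ D closes up.
  have h1 := hleast.2 hZ
  have h2 := hleast.2 hX
  have h3 := hTZ.card_le
  omega
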